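/- A metric space $(X,d)$ is geodesic if any two points $x,y\in X$ are joined by a curve of length $d(x,y)$. A geodesic metric space $(X,d)$ is an Alexandrov space of nonnegative curvature if, for all $x,y,z\in X$ and every minimal geodesic $\gamma:[0,1]\to X$ from $y$ to $z$ (a locally minimizing curve of constant speed and of length $d(y,z)$), $$d\big(x,\gamma(\tfrac12)\big)^2\ \ge\ \tfrac12 d(x,y)^2+\tfrac12 d(x,z)^2-\tfrac14 d(y,z)^2 .$$ For $N\in\mathbb N=\{1,2,\dots\}$, a stationary reversible chain on $\{1,\dots,N\}$ is a pair $(\pi,A)$, $\pi=(\pi_i)_{i=1}^N$, $A=(a_{ij})_{i,j=1}^N$, with $0\le\pi_i\le1$, $0\le a_{ij}\le1$, $\sum_i\pi_i=1$, $\sum_j a_{ij}=1$ and $\pi_ia_{ij}=\pi_ja_{ji}$ for all $i,j$. Write $A^l=(a^{(l)}_{ij})$. A metric space $(X,d)$ has Markov type $2$ if there is a constant $K\ge1$ such that for all $\alpha\in(0,1)$, $N\in\mathbb N$, $x_1,\dots,x_N\in X$ and all stationary reversible chains $(\pi,A)$ on $\{1,\dots,N\}$, $$(1-\alpha)\sum_{i,j=1}^N\pi_i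 c_{ij}\,d(x_i,x_j)^2\ \le\ K^2\alpha\sum_{i,j=1}^N\pi_i a_{ij}\,d(x_i,x_j)^2,\qquad (c_{ij})=(1-\alpha)(I-\alpha A)^{-1};$$ the infimum of such $K\ge 1$ is denoted by $M_2(X)$. **Theorem 4.2.** Let $(X,d)$ be an Alexandrov space of nonnegative curvature. Then $(X,d)$ has Markov type $2$ with $M_2(X)\le 1+\sqrt2$. More precisely, for all $l,N\in\mathbb N$, all $x_1,\dots,x_N\in X$ and all stationary reversible chains $(\pi,A)$ on $\{1,\dots,N\}$, $$\sum_{i,j=1}^N\pi_i a^{(l)}_{ij}\,d(x_i,x_j)^2\ \le\ (1+\sqrt2)^2\,l\sum_{i,j=1}^N\pi_i a_{ij}\,d(x_i,x_j)^2 .$$ -/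

import Mathlib

open scoped ENNReal

namespace MarkovTypeTwo

section Geodesics

variable {X : Type*} [MetricSpace X]

/-- The length of the restriction to `[0,1]` of `γ`: the supremum of the lengths of the inscribed
polygons. Curves `[0,1] → X` are represented by maps `ℝ → X`, of which only the
values on `[0,1]` matter. -/
noncomputable def curveLength (γ : ℝ → X) : ℝ≥0∞ :=
  eVariationOn γ (Set.Icc 0 1)

/-- Any two points are joined by a (continuous) curve whose length is their distance. -/
def IsGeodesicSpace (X : Type*) [MetricSpace X] : Prop :=
  ∀ x y : X, ∃ γ : ℝ → X, ContinuousOn γ (Set.Icc 0 1) ∧ γ 0 = x ∧ γ 1 = y ∧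
    curveLength γ = edist x y

/-- Every time has a neighbourhood in `[0,1]` such that each subarc of `γ` inside this
neighbourhood realizes the distance between its ends. -/
def IsLocallyMinimizing (γ : ℝ → X) : Prop :=
  ∀ t ∈ Set.Icc (0 : ℝ) 1, ∃ ε > 0, ∀ r ∈ Set.Icc (0 : ℝ) 1, ∀ s ∈ Set.Icc (0 : ℝ) 1,
    |r - t| < ε → |s - t| < ε → r ≤ s →
      eVariationOn γ (Set.Icc r s) = edist (γ r) (γ s)

/-- A geodesic: a rectifiable curve which is locally minimizing and has a constant speed. -/
structure IsGeodesic (γ : ℝ → X) : Prop where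
  continuousOn : ContinuousOn γ (Set.Icc 0 1)
  rectifiable : curveLength γ ≠ ∞
  locallyMinimizing : IsLocallyMinimizing γ
  constantSpeed : ∃ v, HasConstantSpeedOnWith γ (Set.Icc 0 1) v

/-- A minimal geodesic: a geodesic whose length is the distance between its ends. -/
structure IsMinimalGeodesic (γ : ℝ → X) : Prop where
  isGeodesic : IsGeodesic γ
  minimal : curveLength γ = edist (γ 0) (γ 1)

/-- Alexandrov spaces of nonnegative curvature: geodesic metric spaces in which the distance
to the midpoint of a minimal geodesic is at least the one in the Euclidean comparison triangle. -/
structure IsAlexandrovNonneg (X : Type*) [MetricSpace X] : Prop where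
  geodesic : IsGeodesicSpace X
  midpoint_le : ∀ (x y z : X) (γ : ℝ → X), IsMinimalGeodesic γ → γ 0 = y → γ 1 = z →
    dist x (γ (1 / 2)) ^ 2 ≥
      1 / 2 * dist x y ^ 2 + 1 / 2 * dist x z ^ 2 - 1 / 4 * dist y z ^ 2

end Geodesics

/-- `π` is an initial distribution and `A` a transition matrix on `N` states which define
a stationary, reversible Markov chain. -/
structure IsReversibleChain {N : ℕ} (π : Fin N → ℝ) (A : Matrix (Fin N) (Fin N) ℝ) : Prop where
  init_nonneg : ∀ i, 0 ≤ π i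
  init_le_one : ∀ i, π i ≤ 1
  trans_nonneg : ∀ i j, 0 ≤ A i j
  trans_le_one : ∀ i j, A i j ≤ 1
  init_sum : ∑ i, π i = 1
  trans_sum : ∀ i, ∑ j, A i j = 1
  reversible : ∀ i j, π i * A i j = π j * A j i

/-- The matrix `C = (1 - α) (I - α A)⁻¹`. -/
noncomputable def resolventMatrix {N : ℕ} (α : ℝ) (A : Matrix (Fin N) (Fin N) ℝ) :
    Matrix (Fin N) (Fin N) ℝ :=
  (1 - α) • (1 - α • A)⁻¹

/-- The inequality defining Markov type `2`, with the constant `K`. -/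
def MarkovTypeTwoWith (X : Type*) [MetricSpace X] (K : ℝ) : Prop :=
  ∀ α : ℝ, 0 < α → α < 1 → ∀ (N : ℕ) (x : Fin N → X) (π : Fin N → ℝ)
    (A : Matrix (Fin N) (Fin N) ℝ), IsReversibleChain π A →
      (1 - α) * ∑ i, ∑ j, π i * resolventMatrix α A i j * dist (x i) (x j) ^ 2 ≤
        K ^ 2 * α * ∑ i, ∑ j, π i * A i j * dist (x i) (x j) ^ 2

/-- `X` has Markov type `2`. -/
def HasMarkovTypeTwo (X : Type*) [MetricSpace X] : Prop :=
  ∃ K : ℝ, 1 ≤ K ∧ MarkovTypeTwoWith X K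

/-- The Markov type constant `M₂(X)` (meaningful if `X` has Markov type `2`). -/
noncomputable def markovConst (X : Type*) [MetricSpace X] : ℝ :=
  sInf {K : ℝ | 1 ≤ K ∧ MarkovTypeTwoWith X K}

end MarkovTypeTwo

namespace MarkovTypeTwo

/-! ### Midpoint comparison and iterated halving. -/

section Midpoints

variable {X : Type*} [MetricSpace X]

/-! Curvature enters only through the Lang–Schroeder–Sturm inequality `sum_sum_dist_sq_le`:
independent points drawn with weights `w` have mean squared distance at most twice their mean
squared distance to any `y`. Conditioning a reversible chain on its state at time `l` makes past and
future independent with the same law, so the inequality gives `E(2l) ≤ 2 E(l)` for the mean squared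
displacement `E`. Hence `E(2^n) ≤ 2^n E(1)`. For general `l`, write `l = 2^n + m` with `m < 2^n`;
the triangle inequality and induction close exactly because `c = 1 + √2` solves `c² = 1 + 2c`.
Summing against `α^l` gives the resolvent form.

The Sturm inequality is a gradient argument at `y`. Let `F = meanSq w x - dist y · ^ 2`, which is
concave along minimal geodesics from `y`. If its gradient at `y` were attained by a direction, the
first variation of distance at nearby points in that direction would give the inequality, up to
errors that vanish at `y`. There is no compactness, so the direction is replaced by a halving
sequence `P` of almost maximizers of `proximal`. Inner products become comparison inner products,
monotone under halving and hence convergent. Only midpoint comparison is needed, applied at dyadic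
points. -/

theorem dist_add_dist_add_dist_of_curveLength_eq {γ : ℝ → X}
    (h : curveLength γ = edist (γ 0) (γ 1)) {s t : ℝ} (h0 : 0 ≤ s) (hst : s ≤ t) (h1 : t ≤ 1) :
    dist (γ 0) (γ s) + dist (γ s) (γ t) + dist (γ t) (γ 1) = dist (γ 0) (γ 1) := by
  refine le_antisymm ?_ ?_
  · have e1 := eVariationOn.Icc_add_Icc γ (s := Set.univ) h0 hst (Set.mem_univ _)
    have e2 := eVariationOn.Icc_add_Icc γ (s := Set.univ) (h0.trans hst) h1 (Set.mem_univ _)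
    simp only [Set.univ_inter] at e1 e2
    have key : edist (γ 0) (γ s) + edist (γ s) (γ t) + edist (γ t) (γ 1) ≤ edist (γ 0) (γ 1) := by
      rw [← h, curveLength, ← e2, ← e1]
      gcongr <;> apply eVariationOn.edist_le <;> simp [*]
    have := ENNReal.toReal_mono (edist_ne_top _ _) key
    rwa [ENNReal.toReal_add (by simp [edist_ne_top]) (edist_ne_top _ _),
      ENNReal.toReal_add (edist_ne_top _ _) (edist_ne_top _ _), ← dist_edist, ← dist_edist,
      ← dist_edist, ← dist_edist] at this
  · linarith [dist_triangle (γ 0) (γ s) (γ 1), dist_triangle (γ s) (γ t) (γ 1)]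

/-- Any two points of a geodesic space are joined by a curve proportional to arclength. -/
theorem IsGeodesicSpace.exists_dist_eq_mul (hX : IsGeodesicSpace X) (y z : X) :
    ∃ γ : ℝ → X, γ 0 = y ∧ γ 1 = z ∧ ∀ s ∈ Set.Icc (0 : ℝ) 1, ∀ t ∈ Set.Icc (0 : ℝ) 1,
      dist (γ s) (γ t) = |s - t| * dist y z := by
  obtain ⟨c, hc, rfl, rfl, hl⟩ := hX y z
  have habs : ∀ s ∈ Set.Icc (0 : ℝ) 1, ∀ t ∈ Set.Icc (0 : ℝ) 1,
      dist (c s) (c t) = |dist (c 0) (c s) - dist (c 0) (c t)| := by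
    have key : ∀ s ∈ Set.Icc (0 : ℝ) 1, ∀ t ∈ Set.Icc (0 : ℝ) 1, s ≤ t →
        dist (c s) (c t) = dist (c 0) (c t) - dist (c 0) (c s) := by
      intro s hs t ht hst
      have e1 := dist_add_dist_add_dist_of_curveLength_eq hl hs.1 hst ht.2
      have e2 := dist_add_dist_add_dist_of_curveLength_eq hl ht.1 le_rfl ht.2
      simp only [dist_self] at e2
      linarith
    intro s hs t ht
    rcases le_total s t with h | h
    · rw [abs_sub_comm, ← key s hs t ht h, abs_of_nonneg dist_nonneg]
    · rw [← key t ht s hs h, abs_of_nonneg dist_nonneg, dist_comm]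
  have hv : ContinuousOn (fun t => dist (c 0) (c t)) (Set.Icc 0 1) := by fun_prop
  -- Reparametrization by the distance from the starting point. Outside `[0,1]` the value is the
  -- default `0`, so that `habs` applies to every chosen time.
  have hsurj : ∀ s : ℝ, ∃ t ∈ Set.Icc (0 : ℝ) 1, s ∈ Set.Icc (0 : ℝ) 1 →
      dist (c 0) (c t) = s * dist (c 0) (c 1) := by
    intro s
    by_cases hs : s ∈ Set.Icc (0 : ℝ) 1
    · obtain ⟨t, ht, e⟩ := intermediate_value_Icc zero_le_one hv
        (show s * dist (c 0) (c 1) ∈ _ from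
          ⟨by simpa using mul_nonneg hs.1 dist_nonneg,
            by simpa using mul_le_mul_of_nonneg_right hs.2 dist_nonneg⟩)
      exact ⟨t, ht, fun _ => e⟩
    · exact ⟨0, by simp, fun h => absurd h hs⟩
  choose τ hτ hτ' using hsurj
  refine ⟨fun s => c (τ s), ?_, ?_, ?_⟩
  · have := hτ' 0 (by simp)
    rw [zero_mul] at this
    exact (dist_eq_zero.1 this).symm
  · have := habs (τ 1) (hτ 1) 1 (by simp)
    rw [hτ' 1 (by simp), one_mul, sub_self, abs_zero] at this
    exact dist_eq_zero.1 this
  · intro s hs t ht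
    rw [habs _ (hτ s) _ (hτ t), hτ' s hs, hτ' t ht, ← sub_mul, abs_mul,
      abs_of_nonneg (dist_nonneg (x := c 0))]

theorem eVariationOn_Icc_of_dist_eq_mul {γ : ℝ → X} {D : ℝ} (hD : 0 ≤ D)
    (h : ∀ s ∈ Set.Icc (0 : ℝ) 1, ∀ t ∈ Set.Icc (0 : ℝ) 1, dist (γ s) (γ t) = |s - t| * D)
    {r s : ℝ} (hr : r ∈ Set.Icc (0 : ℝ) 1) (hs : s ∈ Set.Icc (0 : ℝ) 1) (hrs : r ≤ s) :
    eVariationOn γ (Set.Icc r s) = ENNReal.ofReal (D * (s - r)) := by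
  have hsub : Set.Icc r s ⊆ Set.Icc (0 : ℝ) 1 := Set.Icc_subset_Icc hr.1 hs.2
  refine le_antisymm ?_ ?_
  · have hL : LipschitzOnWith D.toNNReal γ (Set.Icc r s) := by
      refine LipschitzOnWith.of_dist_le_mul fun a ha b hb => ?_
      rw [h a (hsub ha) b (hsub hb), Real.dist_eq, Real.coe_toNNReal _ hD, mul_comm]
    have e := hL.comp_eVariationOn_le (g := id) (s := Set.Icc r s) (fun x hx => hx)
    have e2 := ((monotoneOn_id (s := Set.Icc r s)).eVariationOn_eq (Set.left_mem_Icc.2 hrs)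
      (Set.right_mem_Icc.2 hrs)).le
    rw [Set.inter_self] at e2
    rw [ENNReal.ofReal_mul hD]
    exact e.trans (mul_le_mul' le_rfl e2)
  · have := eVariationOn.edist_le γ (Set.left_mem_Icc.2 hrs) (Set.right_mem_Icc.2 hrs)
    rwa [edist_dist, h r hr s hs, abs_sub_comm, abs_of_nonneg (sub_nonneg.2 hrs), mul_comm] at this

theorem isMinimalGeodesic_of_dist_eq_mul {γ : ℝ → X} {D : ℝ} (hD : 0 ≤ D)
    (h : ∀ s ∈ Set.Icc (0 : ℝ) 1, ∀ t ∈ Set.Icc (0 : ℝ) 1, dist (γ s) (γ t) = |s - t| * D) :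
    IsMinimalGeodesic γ := by
  have hdist : ∀ r ∈ Set.Icc (0 : ℝ) 1, ∀ s ∈ Set.Icc (0 : ℝ) 1, r ≤ s →
      eVariationOn γ (Set.Icc r s) = edist (γ r) (γ s) := by
    intro r hr s hs hrs
    rw [eVariationOn_Icc_of_dist_eq_mul hD h hr hs hrs, edist_dist, h r hr s hs, abs_sub_comm,
      abs_of_nonneg (sub_nonneg.2 hrs), mul_comm]
  have hlen : curveLength γ = edist (γ 0) (γ 1) := hdist 0 (by simp) 1 (by simp) zero_le_one
  refine ⟨⟨?_, ?_, ?_, ⟨D.toNNReal, ?_⟩⟩, hlen⟩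
  · have hL : LipschitzOnWith D.toNNReal γ (Set.Icc 0 1) := by
      refine LipschitzOnWith.of_dist_le_mul fun a ha b hb => ?_
      rw [h a ha b hb, Real.dist_eq, Real.coe_toNNReal _ hD, mul_comm]
    exact hL.continuousOn
  · rw [hlen]; exact edist_ne_top _ _
  · exact fun t _ => ⟨1, one_pos, fun r hr s hs _ _ hrs => hdist r hr s hs hrs⟩
  · rw [hasConstantSpeedOnWith_iff_ordered]
    intro r hr s hs hrs
    rw [Set.inter_eq_right.2 (Set.Icc_subset_Icc hr.1 hs.2), Real.coe_toNNReal _ hD]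
    exact eVariationOn_Icc_of_dist_eq_mul hD h hr hs hrs

/-- `m` lies halfway between `y` and `z`, and its distances to all points are at least those in
the Euclidean comparison triangles. -/
def IsComparisonMidpoint (y z m : X) : Prop :=
  dist y m = dist y z / 2 ∧ ∀ x : X,
    dist x y ^ 2 / 2 + dist x z ^ 2 / 2 - dist y z ^ 2 / 4 ≤ dist x m ^ 2

theorem IsAlexandrovNonneg.exists_isComparisonMidpoint (hX : IsAlexandrovNonneg X) (y z : X) :
    ∃ m, IsComparisonMidpoint y z m := by
  obtain ⟨γ, h0, h1, h⟩ := hX.geodesic.exists_dist_eq_mul y z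
  refine ⟨γ (1 / 2), ?_, fun x => ?_⟩
  · have := h 0 (by simp) (1 / 2) (by norm_num)
    rw [h0] at this
    rw [this]
    norm_num
    ring
  · have := hX.midpoint_le x y z γ (isMinimalGeodesic_of_dist_eq_mul dist_nonneg h) h0 h1
    linarith

/-- `h` is obtained from `h 0` by successively halving towards `y`. -/
def IsHalvingSequence (y : X) (h : ℕ → X) : Prop :=
  ∀ k, IsComparisonMidpoint y (h k) (h (k + 1))

theorem exists_isHalvingSequence (H : ∀ y z : X, ∃ m, IsComparisonMidpoint y z m) (y z : X) :
    ∃ h : ℕ → X, h 0 = z ∧ IsHalvingSequence y h := by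
  choose mid hmid using H
  exact ⟨fun k => (mid y)^[k] z, rfl, fun k => by
    simpa only [Function.iterate_succ_apply'] using hmid y ((mid y)^[k] z)⟩

namespace IsHalvingSequence

variable {y : X} {h : ℕ → X}

theorem shift (hh : IsHalvingSequence y h) (n : ℕ) : IsHalvingSequence y fun k => h (n + k) :=
  fun k => hh (n + k)

theorem dist_eq (hh : IsHalvingSequence y h) (k : ℕ) :
    dist y (h k) = (1 / 2) ^ k * dist y (h 0) := by
  induction k with
  | zero => simp
  | succ k ih => rw [(hh k).1, ih, pow_succ]; ring

/-- The left side is the Euclidean squared distance to the point at fraction `(1/2)^k`; it satisfies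
the midpoint relation with equality, so induction loses nothing. -/
theorem le_dist_sq (hh : IsHalvingSequence y h) (k : ℕ) (x : X) :
    (1 - (1 / 2) ^ k) * dist x y ^ 2 + (1 / 2) ^ k * dist x (h 0) ^ 2
      - (1 / 2) ^ k * (1 - (1 / 2) ^ k) * dist y (h 0) ^ 2 ≤ dist x (h k) ^ 2 := by
  induction k with
  | zero => simp
  | succ k ih =>
    have h1 := (hh k).2 x
    rw [hh.dist_eq k] at h1
    refine le_trans (le_of_eq ?_) ((add_le_add_left (add_le_add_right
      (div_le_div_of_nonneg_right ih (zero_le_two)) (dist x y ^ 2 / 2)) _).trans h1)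
    rw [pow_succ]
    ring

end IsHalvingSequence

end Midpoints

/-! ### The Lang–Schroeder–Sturm inequality. -/

section Sturm

open Filter Topology

variable {X : Type*} [MetricSpace X] {ι : Type*} [Fintype ι]

/-- The mean squared distance from `z` to the points `x i` with weights `w i`. -/
noncomputable def meanSq (w : ι → ℝ) (x : ι → X) (z : X) : ℝ :=
  ∑ i, w i * dist (x i) z ^ 2

/-- The increment from `y` to `z` of `meanSq w x - dist y · ^ 2`, a function which is concave
along minimal geodesics starting at `y`. -/
noncomputable def penalizedIncrement (w : ι → ℝ) (x : ι → X) (y z : X) : ℝ :=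
  meanSq w x z - dist y z ^ 2 - meanSq w x y

variable {w : ι → ℝ} {x : ι → X} {y : X}

theorem IsHalvingSequence.le_meanSq {p : X} {h : ℕ → X} (hh : IsHalvingSequence p h)
    (hw : ∀ i, 0 ≤ w i) (hw1 : ∑ i, w i = 1) (k : ℕ) :
    (1 - (1 / 2) ^ k) * meanSq w x p + (1 / 2) ^ k * meanSq w x (h 0)
      - (1 / 2) ^ k * (1 - (1 / 2) ^ k) * dist p (h 0) ^ 2 ≤ meanSq w x (h k) := by
  have e : (1 / 2 : ℝ) ^ k * (1 - (1 / 2) ^ k) * dist p (h 0) ^ 2 =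
      ∑ i, w i * ((1 / 2) ^ k * (1 - (1 / 2) ^ k) * dist p (h 0) ^ 2) := by
    rw [← Finset.sum_mul, hw1, one_mul]
  rw [e]
  simp only [meanSq, Finset.mul_sum]
  rw [← Finset.sum_add_distrib, ← Finset.sum_sub_distrib]
  refine Finset.sum_le_sum fun i _ => ?_
  nlinarith [mul_le_mul_of_nonneg_left (hh.le_dist_sq k (x i)) (hw i)]

/-- Squaring the triangle inequality produces `dist y z ^ 2`, which the penalty cancels; only a
linear term is left. -/
theorem penalizedIncrement_le (hw : ∀ i, 0 ≤ w i) (hw1 : ∑ i, w i = 1) (z : X) :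
    penalizedIncrement w x y z ≤ (2 * ∑ i, w i * dist (x i) y) * dist y z := by
  have e : dist y z ^ 2 = ∑ i, w i * dist y z ^ 2 := by rw [← Finset.sum_mul, hw1, one_mul]
  rw [penalizedIncrement, e, meanSq, meanSq, ← Finset.sum_sub_distrib, ← Finset.sum_sub_distrib,
    Finset.mul_sum, Finset.sum_mul]
  refine Finset.sum_le_sum fun i _ => ?_
  have h1 : dist (x i) z ^ 2 ≤ (dist (x i) y + dist y z) ^ 2 :=
    pow_le_pow_left₀ dist_nonneg (dist_triangle _ _ _) 2
  nlinarith [mul_le_mul_of_nonneg_left h1 (hw i)]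

/-- Concavity from `y`, where the increment vanishes. -/
theorem IsHalvingSequence.penalizedIncrement_le {h : ℕ → X} (hh : IsHalvingSequence y h)
    (hw : ∀ i, 0 ≤ w i) (hw1 : ∑ i, w i = 1) (k : ℕ) :
    penalizedIncrement w x y (h k) ≤ 2 * penalizedIncrement w x y (h (k + 1)) := by
  have h1 := (hh.shift k).le_meanSq (x := x) hw hw1 1
  have h2 := (hh k).1
  simp only [penalizedIncrement, h2]
  norm_num at h1
  linarith

/-- The functional `z ↦ 2 t (F z - F y) - dist y z ^ 2`, for the function `F` of
`penalizedIncrement`; its maxima approximate the points at distance `t |∇F|` from `y` in the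
direction of the gradient of `F` at `y`. -/
noncomputable def proximal (w : ι → ℝ) (x : ι → X) (y : X) (t : ℝ) (z : X) : ℝ :=
  2 * t * penalizedIncrement w x y z - dist y z ^ 2

theorem proximal_le (hw : ∀ i, 0 ≤ w i) (hw1 : ∑ i, w i = 1) {t : ℝ} (ht : 0 ≤ t) (z : X) :
    proximal w x y t z ≤ t ^ 2 * (2 * ∑ i, w i * dist (x i) y) ^ 2 := by
  have := mul_le_mul_of_nonneg_left (penalizedIncrement_le (x := x) (y := y) hw hw1 z) ht
  rw [proximal]
  nlinarith [sq_nonneg (t * (2 * ∑ i, w i * dist (x i) y) - dist y z)]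

/-- When point and scale are halved together, the quadratic term scales exactly while concavity
favours the linear one. Thus the value divided by the squared scale never decreases. -/
theorem IsHalvingSequence.proximal_le {h : ℕ → X} (hh : IsHalvingSequence y h)
    (hw : ∀ i, 0 ≤ w i) (hw1 : ∑ i, w i = 1) {t : ℝ} (ht : 0 ≤ t) (k : ℕ) :
    proximal w x y t (h 0) ≤ (2 ^ k) ^ 2 * proximal w x y (t * (1 / 2) ^ k) (h k) := by
  induction k with
  | zero => simp
  | succ k ih =>
    refine ih.trans ?_
    have h1 := hh.penalizedIncrement_le (x := x) hw hw1 k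
    have h2 := (hh k).1
    have h3 : (0 : ℝ) ≤ t * (1 / 2) ^ k := by positivity
    have h4 := mul_le_mul_of_nonneg_left h1 h3
    rw [pow_succ (2 : ℝ) k, mul_pow, mul_assoc]
    refine mul_le_mul_of_nonneg_left ?_ (by positivity)
    simp only [proximal, h2, pow_succ (1 / 2 : ℝ) k]
    nlinarith

/-- The supremum runs over points and dyadic scales at once. Halving one near-optimal point then
gives near-optimal points at all smaller scales, with the same error. -/
theorem exists_almost_max_proximal (hw : ∀ i, 0 ≤ w i) (hw1 : ∑ i, w i = 1) {δ : ℝ}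
    (hδ : 0 < δ) : ∃ (n₀ : ℕ) (z₀ : X), ∀ (n : ℕ) (z : X),
      (2 ^ n) ^ 2 * proximal w x y ((1 / 2) ^ n) z ≤
        (2 ^ n₀) ^ 2 * proximal w x y ((1 / 2) ^ n₀) z₀ + δ := by
  set g : ℕ × X → ℝ := fun p => (2 ^ p.1) ^ 2 * proximal w x y ((1 / 2) ^ p.1) p.2 with hg
  have hb : BddAbove (Set.range g) := by
    refine ⟨(2 * ∑ i, w i * dist (x i) y) ^ 2, ?_⟩
    rintro _ ⟨⟨n, z⟩, rfl⟩
    refine (mul_le_mul_of_nonneg_left (proximal_le (t := (1 / 2) ^ n) hw hw1 (by positivity) z)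
      (by positivity)).trans (le_of_eq ?_)
    rw [← mul_assoc, ← mul_pow, ← mul_pow, ← mul_pow]
    norm_num
  have hne : (Set.range g).Nonempty := ⟨_, ⟨(0, y), rfl⟩⟩
  obtain ⟨_, ⟨⟨n₀, z₀⟩, rfl⟩, h⟩ := exists_lt_of_lt_csSup hne (sub_lt_self (sSup (Set.range g)) hδ)
  refine ⟨n₀, z₀, fun n z => ?_⟩
  have := le_csSup hb ⟨(n, z), rfl⟩
  simp only [hg] at this h ⊢
  linarith

/-- Almost optimality of `p`, tested at a point close to `p` in the direction of `q`. -/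
theorem meanSq_sub_le_of_almost_max (H : ∀ y z : X, ∃ m, IsComparisonMidpoint y z m)
    (hw : ∀ i, 0 ≤ w i) (hw1 : ∑ i, w i = 1) {p p' q : X} (hp : IsComparisonMidpoint y p' p)
    {t u δ : ℝ} (ht : 0 < t) (hu : dist y p = u * t)
    (hmax : ∀ z, proximal w x y t z ≤ proximal w x y t p + 2 * t ^ 2 * δ) (e : ℕ) :
    2 * t * (meanSq w x q - meanSq w x p) ≤ 2 * t ^ 2 * (δ * 2 ^ e) + 2 * t * dist p q ^ 2
      + (2 * t + 1) * (u ^ 2 * t ^ 2 - dist p' q ^ 2 + dist p q ^ 2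
        + (1 / 2) ^ e * dist p q ^ 2) := by
  obtain ⟨h, rfl, hh⟩ := exists_isHalvingSequence H p q
  set ε : ℝ := (1 / 2) ^ e with hε
  have hε0 : 0 < ε := by positivity
  have hε2 : ε * 2 ^ e = 1 := by rw [hε, ← mul_pow]; norm_num
  have h1 := hh.le_meanSq (x := x) hw hw1 e
  have h2 := hh.le_dist_sq e p'
  have h3 := hh.dist_eq e
  rw [← hε] at h1 h2 h3
  have h4 := hp.2 (h e)
  have hyp' : dist y p' = 2 * (u * t) := by linarith [hp.1]
  have hpp' : (u * t) ^ 2 ≤ dist p' p ^ 2 := by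
    have : 0 ≤ u * t := hu ▸ dist_nonneg
    refine pow_le_pow_left₀ this ?_ 2
    linarith [dist_triangle y p p', dist_comm p p']
  have hε1 : ε ≤ 1 := pow_le_one₀ (by norm_num) (by norm_num)
  have hm := hmax (h e)
  simp only [proximal, penalizedIncrement] at hm
  rw [dist_comm (h e) y, dist_comm (h e) p', dist_comm (h e) p, h3, hyp'] at h4
  rw [hu] at hm
  have h5 := mul_le_mul_of_nonneg_left hpp' (sub_nonneg.2 hε1)
  -- First variation from above: as `p` is the midpoint of `y` and `p'`, a lower bound for the
  -- distance to `p'` bounds the one to `y`.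
  have h6 : dist y (h e) ^ 2 ≤ u ^ 2 * t ^ 2 + ε * (u ^ 2 * t ^ 2 - dist p' (h 0) ^ 2
      + dist p (h 0) ^ 2 + ε * dist p (h 0) ^ 2) := by nlinarith
  have h7 := mul_le_mul_of_nonneg_left h6 (by positivity : 0 ≤ 2 * t + 1)
  have h8 := mul_le_mul_of_nonneg_left h1 (by positivity : 0 ≤ 2 * t)
  have h9 : 0 ≤ 2 * t * ε ^ 2 * dist p (h 0) ^ 2 := by positivity
  refine le_of_mul_le_mul_left ?_ hε0
  have h10 : ε * (2 * t ^ 2 * (δ * 2 ^ e)) = 2 * t ^ 2 * δ := by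
    rw [← mul_one (2 * t ^ 2 * δ), ← hε2]; ring
  rw [mul_add, mul_add, h10]
  nlinarith

/-- Monotonicity of comparison angles, along two sequences halving towards `y`. -/
theorem comparison_monotone {P Q : ℕ → X} (hP : IsHalvingSequence y P)
    (hQ : IsHalvingSequence y Q) (j : ℕ) :
    dist (P j) (Q j) ^ 2 / 2 + 2 * dist y (P (j + 1)) ^ 2 - dist y (Q (j + 1)) ^ 2 ≤
        dist (P j) (Q (j + 1)) ^ 2 ∧
      dist (P j) (Q (j + 1)) ^ 2 / 2 + dist y (Q (j + 1)) ^ 2 / 2 - dist y (P (j + 1)) ^ 2 ≤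
        dist (P (j + 1)) (Q (j + 1)) ^ 2 := by
  have h1 := (hQ j).2 (P j)
  have h2 := (hP j).2 (Q (j + 1))
  have h3 : dist y (Q j) = 2 * dist y (Q (j + 1)) := by linarith [(hQ j).1]
  have h4 : dist y (P j) = 2 * dist y (P (j + 1)) := by linarith [(hP j).1]
  rw [dist_comm (P j) y, h3, h4] at h1
  rw [dist_comm _ y, dist_comm _ (P j), dist_comm _ (P (j + 1)), h4] at h2
  constructor <;> linarith

/-- The increments at almost optimal points, in the limit. -/
theorem sum_dist_sq_sub_le_of_almost_max (H : ∀ y z : X, ∃ m, IsComparisonMidpoint y z m)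
    (hw : ∀ i, 0 ≤ w i) (hw1 : ∑ i, w i = 1) {P : ℕ → X} {Q : ι → ℕ → X}
    (hP : IsHalvingSequence y P) (hQ : ∀ i, IsHalvingSequence y (Q i)) {T : ℕ → ℝ}
    (hT0 : ∀ j, 0 < T j) (hT : ∀ j, T j = 2 * T (j + 1)) (hTlim : Tendsto T atTop (𝓝 0))
    {u δ : ℝ} (hu : ∀ j, dist y (P j) = u * T j)
    (hr : ∀ i j, dist y (Q i j) = dist (x i) y * T j)
    (hQx : ∀ i j z, (1 - T j) * dist z y ^ 2 + T j * dist z (x i) ^ 2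
      - T j * (1 - T j) * dist (x i) y ^ 2 ≤ dist z (Q i j) ^ 2)
    (hmax : ∀ j z, proximal w x y (T j) z ≤ proximal w x y (T j) (P j) + 2 * T j ^ 2 * δ)
    (hδ : 0 ≤ δ) (e : ℕ) :
    ∑ i, ∑ j, w i * w j * dist (x i) (x j) ^ 2 - 2 * meanSq w x y ≤
      δ + δ * 2 ^ e + (1 / 2) ^ e * ∑ i, w i * (u + dist (x i) y) ^ 2 := by
  set r : ι → ℝ := fun i => dist (x i) y with hrdef
  set K : ℝ := ∑ i, w i * (u + r i) ^ 2 with hK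
  set S : ℝ := ∑ i, ∑ j, w i * w j * dist (x i) (x j) ^ 2 - 2 * meanSq w x y with hS
  -- By the law of cosines, `a j i` is the comparison inner product at `y` of `P j` and `Q i j`, and
  -- `b j i` that of `P j` and `Q i (j + 1)`, each divided by the scales of its two points.
  set a : ℕ → ι → ℝ := fun j i =>
    (u ^ 2 + r i ^ 2) / 2 - dist (P j) (Q i j) ^ 2 / (2 * T j ^ 2) with ha
  set b : ℕ → ι → ℝ := fun j i =>
    (4 * u ^ 2 + r i ^ 2) / 4 - dist (P j) (Q i (j + 1)) ^ 2 / (4 * T (j + 1) ^ 2) with hb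
  have had : ∀ j i, dist (P j) (Q i j) ^ 2 = T j ^ 2 * (u ^ 2 + r i ^ 2 - 2 * a j i) := by
    intro j i
    have := (hT0 j).ne'
    simp only [ha]
    field_simp
    ring
  have hbd : ∀ j i, dist (P j) (Q i (j + 1)) ^ 2 =
      T (j + 1) ^ 2 * (4 * u ^ 2 + r i ^ 2 - 4 * b j i) := by
    intro j i
    have := (hT0 (j + 1)).ne'
    simp only [hb]
    field_simp
    ring
  have hDle : ∀ j i, u ^ 2 + r i ^ 2 - 2 * a j i ≤ (u + r i) ^ 2 := by
    intro j i
    refine le_of_mul_le_mul_left ?_ (pow_pos (hT0 j) 2)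
    rw [← had, ← mul_pow]
    refine pow_le_pow_left₀ dist_nonneg ?_ 2
    have := dist_triangle_left (P j) (Q i j) y
    rw [hu, hr] at this
    linarith
  have hba : ∀ j i, b j i ≤ a j i := by
    intro j i
    have h1 := (comparison_monotone hP (hQ i) j).1
    rw [had, hbd, hu, hr, hT j] at h1
    refine le_of_mul_le_mul_left ?_ (pow_pos (hT0 (j + 1)) 2)
    simp only [hrdef] at h1 ⊢
    linarith
  have hab : ∀ j i, a (j + 1) i ≤ b j i := by
    intro j i
    have h1 := (comparison_monotone hP (hQ i) j).2
    rw [had, hbd, hu, hr] at h1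
    refine le_of_mul_le_mul_left ?_ (pow_pos (hT0 (j + 1)) 2)
    simp only [hrdef] at h1 ⊢
    linarith
  have ha_low : ∀ j i, -(u * r i) ≤ a j i := fun j i => by linarith [hDle j i]
  set A : ℕ → ℝ := fun j => ∑ i, w i * a j i with hA
  set B : ℕ → ℝ := fun j => ∑ i, w i * b j i with hB
  have hBA : ∀ j, B j ≤ A j := fun j =>
    Finset.sum_le_sum fun i _ => mul_le_mul_of_nonneg_left (hba j i) (hw i)
  have hAB : ∀ j, A (j + 1) ≤ B j := fun j =>
    Finset.sum_le_sum fun i _ => mul_le_mul_of_nonneg_left (hab j i) (hw i)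
  have hA_low : ∀ j, -∑ i, w i * (u * r i) ≤ A j := fun j => by
    rw [← Finset.sum_neg_distrib]
    exact Finset.sum_le_sum fun i _ => by
      rw [← mul_neg]; exact mul_le_mul_of_nonneg_left (ha_low j i) (hw i)
  have hA_anti : Antitone A := antitone_nat_of_succ_le fun j => (hAB j).trans (hBA j)
  obtain ⟨β, hAβ⟩ : ∃ β, Tendsto A atTop (𝓝 β) :=
    ⟨_, tendsto_atTop_ciInf hA_anti ⟨_, by rintro _ ⟨j, rfl⟩; exact hA_low j⟩⟩
  have hAβ' : Tendsto (fun j => A (j + 1)) atTop (𝓝 β) := (tendsto_add_atTop_iff_nat 1).2 hAβ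
  have hBβ : Tendsto B atTop (𝓝 β) :=
    tendsto_of_tendsto_of_tendsto_of_le_of_le hAβ' hAβ hAB hBA
  set W : ℕ → ℝ := fun j => penalizedIncrement w x y (P j) / T j with hW
  have hWd : ∀ j, penalizedIncrement w x y (P j) = T j * W j := by
    intro j
    have := (hT0 j).ne'
    simp only [hW]
    field_simp
  have hWmono : Monotone W := monotone_nat_of_le_succ fun j => by
    have h1 := hP.penalizedIncrement_le (x := x) hw hw1 j
    rw [hWd, hWd, hT j] at h1
    refine le_of_mul_le_mul_left ?_ (hT0 (j + 1))
    linarith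
  -- Comparison on the way from `y` to `x i`, seen from `P j`, bounds `dist (x i) (P j)` from above.
  have hWA : ∀ j, W j ≤ -2 * A j := by
    intro j
    refine le_of_mul_le_mul_left ?_ (hT0 j)
    have h2 : ∀ i, w i * dist (x i) (P j) ^ 2 ≤
        w i * (u ^ 2 * T j ^ 2) + w i * dist (x i) y ^ 2 - 2 * T j * (w i * a j i) := by
      intro i
      have h3 := hQx i j (P j)
      rw [had, dist_comm (P j) y, hu, dist_comm (P j)] at h3
      have h4 : dist (x i) (P j) ^ 2 ≤
          u ^ 2 * T j ^ 2 + dist (x i) y ^ 2 - 2 * T j * a j i := by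
        refine le_of_mul_le_mul_left ?_ (hT0 j)
        simp only [hrdef] at h3
        linarith
      linarith [mul_le_mul_of_nonneg_left h4 (hw i)]
    have h5 := Finset.sum_le_sum fun i (_ : i ∈ Finset.univ) => h2 i
    rw [Finset.sum_sub_distrib, Finset.sum_add_distrib, ← Finset.sum_mul, hw1,
      ← Finset.mul_sum] at h5
    rw [← hWd, penalizedIncrement, hu, meanSq, meanSq]
    simp only [hA]
    linarith
  obtain ⟨ω, hWω⟩ : ∃ ω, Tendsto W atTop (𝓝 ω) := by
    refine ⟨_, tendsto_atTop_ciSup hWmono ⟨2 * ∑ i, w i * (u * r i), ?_⟩⟩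
    rintro _ ⟨j, rfl⟩
    linarith [hWA j, hA_low j]
  have hWω' : Tendsto (fun j => W (j + 1)) atTop (𝓝 ω) := (tendsto_add_atTop_iff_nat 1).2 hWω
  have hωβ : ω ≤ -2 * β := le_of_tendsto_of_tendsto' hWω (hAβ.const_mul _) hWA
  -- The competitor at scale `T (j + 1)` is `P j`, twice as far from `y`.
  have hωu : 4 * ω - 2 * ω ≤ 3 * u ^ 2 + 2 * δ := by
    refine le_of_tendsto' ((hWω.const_mul 4).sub (hWω'.const_mul 2)) fun j => ?_
    have h1 := hmax (j + 1) (P j)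
    simp only [proximal, hWd, hu] at h1
    rw [hT j] at h1
    refine le_of_mul_le_mul_left ?_ (pow_pos (hT0 (j + 1)) 2)
    linarith
  have hTlim' : Tendsto (fun j => T (j + 1)) atTop (𝓝 0) := (tendsto_add_atTop_iff_nat 1).2 hTlim
  -- Almost optimality of `P (j + 1)`, tested towards each `Q i (j + 1)` and averaged over `i`; the
  -- zeros are limits of `T (j + 1)`.
  have hmain : 2 * (S - ω - u ^ 2 * 0) ≤ 2 * (δ * 2 ^ e) + 2 * 0 * K
      + (2 * 0 + 1) * (-2 * u ^ 2 + 4 * β - 2 * β + (1 / 2) ^ e * K) := by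
    refine le_of_tendsto_of_tendsto'
      (((tendsto_const_nhds.sub hWω').sub (hTlim'.const_mul (u ^ 2))).const_mul 2)
      ((tendsto_const_nhds.add ((hTlim'.const_mul 2).mul_const K)).add
        (((hTlim'.const_mul 2).add_const 1).mul
          (((tendsto_const_nhds.add (hBβ.const_mul 4)).sub (hAβ'.const_mul 2)).add_const _)))
      fun j => ?_
    have ht := hT0 (j + 1)
    set t := T (j + 1) with htdef
    have h1 : ∀ i, 2 * t * (meanSq w x (Q i (j + 1)) - meanSq w x (P (j + 1))) ≤
        t ^ 2 * (2 * (δ * 2 ^ e) + 2 * t * (u + r i) ^ 2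
          + (2 * t + 1) * (-2 * u ^ 2 + 4 * b j i - 2 * a (j + 1) i
            + (1 / 2) ^ e * (u + r i) ^ 2)) := by
      intro i
      have h2 := meanSq_sub_le_of_almost_max H hw hw1 (q := Q i (j + 1)) (hP j) ht (hu (j + 1))
        (hmax (j + 1)) e
      rw [had, hbd, ← htdef] at h2
      have h3 := mul_le_mul_of_nonneg_left (hDle (j + 1) i)
        (by positivity : 0 ≤ t ^ 2 * (2 * t + (2 * t + 1) * (1 / 2) ^ e))
      linarith
    have h4 := Finset.sum_le_sum fun i (_ : i ∈ Finset.univ) =>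
      mul_le_mul_of_nonneg_left (h1 i) (hw i)
    have h5 : ∑ i, w i * (t ^ 2 * (2 * (δ * 2 ^ e) + 2 * t * (u + r i) ^ 2
          + (2 * t + 1) * (-2 * u ^ 2 + 4 * b j i - 2 * a (j + 1) i
            + (1 / 2) ^ e * (u + r i) ^ 2))) =
        t ^ 2 * (2 * (δ * 2 ^ e) + 2 * t * K
          + (2 * t + 1) * (-2 * u ^ 2 + 4 * B j - 2 * A (j + 1) + (1 / 2) ^ e * K)) := by
      trans ∑ i, (w i * (t ^ 2 * (2 * (δ * 2 ^ e) + (2 * t + 1) * (-2 * u ^ 2)))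
          + t ^ 2 * (2 * t + (2 * t + 1) * (1 / 2) ^ e) * (w i * (u + r i) ^ 2)
          + t ^ 2 * (2 * t + 1) * 4 * (w i * b j i)
          - t ^ 2 * (2 * t + 1) * 2 * (w i * a (j + 1) i))
      · exact Finset.sum_congr rfl fun i _ => by ring
      · rw [Finset.sum_sub_distrib, Finset.sum_add_distrib, Finset.sum_add_distrib,
          ← Finset.sum_mul, ← Finset.mul_sum, ← Finset.mul_sum, ← Finset.mul_sum, hw1]
        simp only [hK, hA, hB]
        ring
    have h6 : ∑ i, w i * (2 * t * (meanSq w x (Q i (j + 1)) - meanSq w x (P (j + 1)))) =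
        2 * t * (∑ i, w i * meanSq w x (Q i (j + 1)) - meanSq w x (P (j + 1))) := by
      trans ∑ i, (2 * t * (w i * meanSq w x (Q i (j + 1)))
          - w i * (2 * t * meanSq w x (P (j + 1))))
      · exact Finset.sum_congr rfl fun i _ => by ring
      · rw [Finset.sum_sub_distrib, ← Finset.sum_mul, ← Finset.mul_sum, hw1]
        ring
    have h7 : meanSq w x y + t * S ≤ ∑ i, w i * meanSq w x (Q i (j + 1)) := by
      have e2 : t ^ 2 * meanSq w x y + (meanSq w x y + t * S) =
          ∑ i, w i * ∑ k, w k * ((1 - t) * dist (x k) y ^ 2 + t * dist (x k) (x i) ^ 2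
            - t * (1 - t) * dist (x i) y ^ 2) := by
        have e3 : ∀ i, ∑ k, w k * ((1 - t) * dist (x k) y ^ 2 + t * dist (x k) (x i) ^ 2
            - t * (1 - t) * dist (x i) y ^ 2) =
            (1 - t) * meanSq w x y + t * ∑ k, w k * dist (x i) (x k) ^ 2
              - t * (1 - t) * dist (x i) y ^ 2 := by
          intro i
          trans ∑ k, ((1 - t) * (w k * dist (x k) y ^ 2) + t * (w k * dist (x i) (x k) ^ 2)
            - w k * (t * (1 - t) * dist (x i) y ^ 2))
          · exact Finset.sum_congr rfl fun k _ => by rw [dist_comm (x k) (x i)]; ring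
          · rw [Finset.sum_sub_distrib, Finset.sum_add_distrib, ← Finset.sum_mul,
              ← Finset.mul_sum, ← Finset.mul_sum, hw1, one_mul, meanSq]
        simp only [e3]
        have e4 : ∑ i, w i * ((1 - t) * meanSq w x y + t * ∑ k, w k * dist (x i) (x k) ^ 2
              - t * (1 - t) * dist (x i) y ^ 2) =
            (∑ i, w i) * ((1 - t) * meanSq w x y)
              + t * ∑ i, ∑ k, w i * w k * dist (x i) (x k) ^ 2
              - t * (1 - t) * meanSq w x y := by
          trans ∑ i, (w i * ((1 - t) * meanSq w x y)
            + t * (w i * ∑ k, w k * dist (x i) (x k) ^ 2)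
            - t * (1 - t) * (w i * dist (x i) y ^ 2))
          · exact Finset.sum_congr rfl fun i _ => by ring
          · rw [Finset.sum_sub_distrib, Finset.sum_add_distrib, ← Finset.sum_mul,
              ← Finset.mul_sum, ← Finset.mul_sum]
            simp only [meanSq, mul_assoc (w _), ← Finset.mul_sum]
        rw [e4, hw1, hS]
        ring
      have e5 : ∑ i, w i * ∑ k, w k * ((1 - t) * dist (x k) y ^ 2 + t * dist (x k) (x i) ^ 2
            - t * (1 - t) * dist (x i) y ^ 2) ≤ ∑ i, w i * meanSq w x (Q i (j + 1)) :=
        Finset.sum_le_sum fun i _ => mul_le_mul_of_nonneg_left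
          (Finset.sum_le_sum fun k _ =>
            mul_le_mul_of_nonneg_left (hQx i (j + 1) (x k)) (hw k)) (hw i)
      have e6 : 0 ≤ t ^ 2 * meanSq w x y := by
        have : 0 ≤ meanSq w x y :=
          Finset.sum_nonneg fun i _ => mul_nonneg (hw i) (sq_nonneg _)
        positivity
      linarith
    rw [h5, h6] at h4
    have h8 := hWd (j + 1)
    rw [penalizedIncrement, hu, ← htdef] at h8
    have h9 := mul_le_mul_of_nonneg_left h7 (by positivity : 0 ≤ 2 * t)
    refine le_of_mul_le_mul_left ?_ (pow_pos ht 2)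
    refine le_trans (le_of_eq ?_) (le_trans (sub_le_sub_right h9
      (2 * t * meanSq w x (P (j + 1)))) (by linarith))
    have h10 : meanSq w x (P (j + 1)) = t * W (j + 1) + meanSq w x y + (u * t) ^ 2 := by linarith
    rw [h10]
    ring
  have : 0 ≤ (1 / 2 : ℝ) ^ e * K :=
    mul_nonneg (by positivity) (Finset.sum_nonneg fun i _ => mul_nonneg (hw i) (sq_nonneg _))
  have := sq_nonneg u
  -- Up to errors `S ≤ ω + β - u²`; with `β ≤ -ω/2` and `ω ≤ 3u²/2 + δ` the main part is at most
  -- `-u²/4`.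
  linarith

/-- The Lang–Schroeder–Sturm inequality. -/
theorem sum_sum_dist_sq_le (H : ∀ y z : X, ∃ m, IsComparisonMidpoint y z m)
    (hw : ∀ i, 0 ≤ w i) (hw1 : ∑ i, w i = 1) (x : ι → X) (y : X) :
    ∑ i, ∑ j, w i * w j * dist (x i) (x j) ^ 2 ≤ 2 * ∑ i, w i * dist (x i) y ^ 2 := by
  set L : ℝ := 2 * ∑ i, w i * dist (x i) y with hL
  have hL0 : 0 ≤ L :=
    mul_nonneg zero_le_two (Finset.sum_nonneg fun i _ => mul_nonneg (hw i) dist_nonneg)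
  set K : ℝ := ∑ i, w i * (2 * L + 1 + dist (x i) y) ^ 2 with hK
  choose q hq0 hq using fun i => exists_isHalvingSequence H y (x i)
  have key : ∀ e : ℕ, ∀ δ : ℝ, 0 < δ → δ ≤ 1 / 2 →
      ∑ i, ∑ j, w i * w j * dist (x i) (x j) ^ 2 - 2 * meanSq w x y ≤
        δ + δ * 2 ^ e + (1 / 2) ^ e * K := by
    intro e δ hδ hδ2
    obtain ⟨n, z, hmax⟩ := exists_almost_max_proximal (x := x) (y := y) hw hw1
      (mul_pos two_pos hδ)
    obtain ⟨P, rfl, hP⟩ := exists_isHalvingSequence H y z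
    set u : ℝ := 2 ^ n * dist y (P 0) with hu
    have hu0 : 0 ≤ u := by positivity
    have h2n : ∀ n : ℕ, (2 : ℝ) ^ n * (1 / 2) ^ n = 1 := fun n => by rw [← mul_pow]; norm_num
    have hdu : dist y (P 0) = u * (1 / 2) ^ n := by
      rw [hu, mul_right_comm, h2n, one_mul]
    -- Comparison with the value `0` at `y` gives `u² ≤ 2 L u + 2 δ`. The bound is uniform in `δ`,
    -- as the limit needs.
    have huL : u ≤ 2 * L + 1 := by
      have h1 := hmax 0 y
      have h2 := mul_le_mul_of_nonneg_left (penalizedIncrement_le (x := x) (y := y) hw hw1 (P 0))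
        (by positivity : (0 : ℝ) ≤ (2 ^ n) ^ 2 * (2 * (1 / 2) ^ n))
      have h3 : (2 ^ n) ^ 2 * (2 * (1 / 2) ^ n) * (L * (u * (1 / 2) ^ n)) =
          2 * L * u * (2 ^ n * (1 / 2) ^ n) ^ 2 := by ring
      have h4 : (2 ^ n) ^ 2 * (u * (1 / 2) ^ n) ^ 2 = u ^ 2 * (2 ^ n * (1 / 2) ^ n) ^ 2 := by ring
      rw [hdu, h3, h2n] at h2
      simp only [proximal, hdu, mul_sub, h4, h2n] at h1
      simp only [penalizedIncrement, dist_self] at h1 h2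
      by_contra! hcon
      nlinarith
    have hT : ∀ j, proximal w x y ((1 / 2) ^ n) (P 0) ≤
        (2 ^ j) ^ 2 * proximal w x y ((1 / 2) ^ (n + j)) (P j) := by
      intro j
      rw [pow_add]
      exact hP.proximal_le hw hw1 (by positivity) j
    have hr : ∀ i, dist y (x i) = dist (x i) y := fun i => dist_comm _ _
    have := sum_dist_sq_sub_le_of_almost_max (x := x) (Q := fun i j => q i (n + j))
      (T := fun j => (1 / 2) ^ (n + j)) (u := u) (δ := δ) H hw hw1 hP
      (fun i => (hq i).shift n) (fun j => by positivity)
      (fun j => by rw [← add_assoc, pow_succ]; ring)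
      (by
        simp only [pow_add]
        simpa using (tendsto_pow_atTop_nhds_zero_of_lt_one (by norm_num : (0 : ℝ) ≤ 1 / 2)
          (by norm_num)).const_mul ((1 / 2 : ℝ) ^ n))
      (fun j => by rw [hP.dist_eq, hdu, pow_add]; ring)
      (fun i j => by rw [(hq i).dist_eq, hq0, hr]; ring)
      (fun i j z => by
        have := (hq i).le_dist_sq (n + j) z
        rwa [hq0, hr] at this)
      (fun j z => by
        have h1 := hmax (n + j) z
        have h2 := mul_le_mul_of_nonneg_left (hT j) (by positivity : (0 : ℝ) ≤ (2 ^ n) ^ 2)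
        rw [← mul_assoc, ← mul_pow, ← pow_add] at h2
        have h3 : (0 : ℝ) < (2 ^ (n + j)) ^ 2 := by positivity
        refine le_of_mul_le_mul_left ?_ h3
        have h4 : (2 ^ (n + j)) ^ 2 * (2 * ((1 / 2) ^ (n + j)) ^ 2 * δ) =
            2 * δ * ((2 : ℝ) ^ (n + j) * (1 / 2) ^ (n + j)) ^ 2 := by ring
        rw [mul_add, h4, h2n]
        linarith)
      hδ.le e
    refine this.trans ?_
    have hmono : ∑ i, w i * (u + dist (x i) y) ^ 2 ≤ K :=
      Finset.sum_le_sum fun i _ => mul_le_mul_of_nonneg_left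
        (pow_le_pow_left₀ (by positivity) (by linarith) 2) (hw i)
    gcongr
  have h1 : ∀ e : ℕ, ∑ i, ∑ j, w i * w j * dist (x i) (x j) ^ 2 - 2 * meanSq w x y ≤
      (1 / 2) ^ e * K := by
    intro e
    refine le_of_forall_pos_le_add fun η hη => ?_
    have hc : (0 : ℝ) < 1 + 2 ^ e := by positivity
    -- The error `δ * 2 ^ e` forces `δ → 0` for fixed `e`, before `e → ∞`.
    have := key e (min (1 / 2) (η / (1 + 2 ^ e))) (lt_min (by norm_num) (by positivity))
      (min_le_left _ _)
    have h2 : min (1 / 2) (η / (1 + 2 ^ e)) * (1 + 2 ^ e) ≤ η :=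
      (mul_le_mul_of_nonneg_right (min_le_right _ _) hc.le).trans
        (div_mul_cancel₀ _ hc.ne').le
    linarith
  have h2 : Tendsto (fun e : ℕ => (1 / 2 : ℝ) ^ e * K) atTop (𝓝 0) := by
    simpa using (tendsto_pow_atTop_nhds_zero_of_lt_one (by norm_num : (0 : ℝ) ≤ 1 / 2)
      (by norm_num)).mul_const K
  have h3 := ge_of_tendsto' h2 h1
  simp only [meanSq] at h3
  linarith

end Sturm

/-! ### Growth of the energy of reversible chains. -/

section Chains

variable {X : Type*} [MetricSpace X] {N : ℕ} {π : Fin N → ℝ} {A : Matrix (Fin N) (Fin N) ℝ}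

/-- The mean squared displacement of the chain after `l` steps. -/
noncomputable def energy (x : Fin N → X) (π : Fin N → ℝ) (A : Matrix (Fin N) (Fin N) ℝ) (l : ℕ) :
    ℝ :=
  ∑ i, ∑ j, π i * (A ^ l) i j * dist (x i) (x j) ^ 2

namespace IsReversibleChain

theorem pow_nonneg (h : IsReversibleChain π A) (l : ℕ) (i j : Fin N) : 0 ≤ (A ^ l) i j := by
  induction l generalizing i j with
  | zero => rw [pow_zero, Matrix.one_apply]; split_ifs <;> norm_num
  | succ l ih =>
    rw [pow_succ, Matrix.mul_apply]
    exact Finset.sum_nonneg fun k _ => mul_nonneg (ih i k) (h.trans_nonneg k j)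

theorem pow_sum (h : IsReversibleChain π A) (l : ℕ) (i : Fin N) : ∑ j, (A ^ l) i j = 1 := by
  induction l generalizing i with
  | zero => simp [Matrix.one_apply]
  | succ l ih =>
    simp only [pow_succ, Matrix.mul_apply]
    rw [Finset.sum_comm]
    simp only [← Finset.mul_sum, h.trans_sum, mul_one, ih]

theorem pow_reversible (h : IsReversibleChain π A) (l : ℕ) (i j : Fin N) :
    π i * (A ^ l) i j = π j * (A ^ l) j i := by
  induction l generalizing i j with
  | zero =>
    by_cases hij : i = j
    · rw [hij]
    · simp [hij, Ne.symm hij]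
  | succ l ih =>
    rw [pow_succ, Matrix.mul_apply, ← pow_succ, pow_succ', Matrix.mul_apply, Finset.mul_sum,
      Finset.mul_sum]
    refine Finset.sum_congr rfl fun k _ => ?_
    rw [← mul_assoc, ih i k, mul_right_comm, h.reversible k j]
    ring

theorem energy_nonneg (h : IsReversibleChain π A) (x : Fin N → X) (l : ℕ) :
    0 ≤ energy x π A l :=
  Finset.sum_nonneg fun i _ => Finset.sum_nonneg fun j _ =>
    mul_nonneg (mul_nonneg (h.init_nonneg i) (h.pow_nonneg l i j)) (sq_nonneg _)

/-- By reversibility, given the middle state `k`, both ends are independent with law `(A ^ l) k`;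
Sturm's inequality applies with `y = x k`. -/
theorem energy_two_mul_le (h : IsReversibleChain π A)
    (H : ∀ y z : X, ∃ m, IsComparisonMidpoint y z m) (x : Fin N → X) (l : ℕ) :
    energy x π A (2 * l) ≤ 2 * energy x π A l := by
  have e1 : energy x π A (2 * l) =
      ∑ k, π k * ∑ i, ∑ j, (A ^ l) k i * (A ^ l) k j * dist (x i) (x j) ^ 2 := by
    simp only [energy, two_mul, pow_add, Matrix.mul_apply, Finset.mul_sum, Finset.sum_mul]
    rw [Finset.sum_comm' (t' := Finset.univ) (s' := fun _ => Finset.univ) (by simp)]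
    conv_rhs => rw [Finset.sum_comm]
    rw [Finset.sum_comm]
    refine Finset.sum_congr rfl fun i _ => ?_
    rw [Finset.sum_comm]
    refine Finset.sum_congr rfl fun k _ => Finset.sum_congr rfl fun j _ => ?_
    rw [← mul_assoc, ← mul_assoc, ← mul_assoc, h.pow_reversible l i k]
  have e2 : energy x π A l = ∑ k, π k * ∑ i, (A ^ l) k i * dist (x i) (x k) ^ 2 := by
    simp only [energy, Finset.mul_sum, mul_assoc]
    exact Finset.sum_congr rfl fun k _ => Finset.sum_congr rfl fun i _ => by
      rw [dist_comm (x i)]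
  rw [e1, e2, Finset.mul_sum]
  refine Finset.sum_le_sum fun k _ => ?_
  rw [mul_left_comm]
  exact mul_le_mul_of_nonneg_left
    (sum_sum_dist_sq_le H (h.pow_nonneg l k) (h.pow_sum l k) x (x k)) (h.init_nonneg k)

theorem energy_two_pow_le (h : IsReversibleChain π A)
    (H : ∀ y z : X, ∃ m, IsComparisonMidpoint y z m) (x : Fin N → X) (n : ℕ) :
    energy x π A (2 ^ n) ≤ 2 ^ n * energy x π A 1 := by
  induction n with
  | zero => simp
  | succ n ih =>
    rw [pow_succ', pow_succ', mul_assoc]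
    exact (h.energy_two_mul_le H x _).trans (mul_le_mul_of_nonneg_left ih zero_le_two)

/-- Triangle inequality through the state at time `l`, with a weighted Young inequality. -/
theorem energy_add_le (h : IsReversibleChain π A) (x : Fin N → X) (l m : ℕ) {s : ℝ}
    (hs : 0 < s) :
    energy x π A (l + m) ≤ (1 + s) * energy x π A l + (1 + s⁻¹) * energy x π A m := by
  have e0 : ∀ f : Fin N → Fin N → Fin N → ℝ,
      ∑ i, ∑ j, ∑ k, π i * ((A ^ l) i k * (A ^ m) k j) * f i j k =
        ∑ i, ∑ k, π i * (A ^ l) i k * ∑ j, (A ^ m) k j * f i j k := by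
    intro f
    refine Finset.sum_congr rfl fun i _ => ?_
    rw [Finset.sum_comm]
    refine Finset.sum_congr rfl fun k _ => ?_
    rw [Finset.mul_sum]
    exact Finset.sum_congr rfl fun j _ => by ring
  have e1 : energy x π A (l + m) = ∑ i, ∑ j, ∑ k,
      π i * ((A ^ l) i k * (A ^ m) k j) * dist (x i) (x j) ^ 2 := by
    simp only [energy, pow_add, Matrix.mul_apply, Finset.mul_sum, Finset.sum_mul]
  have e2 : energy x π A l = ∑ i, ∑ j, ∑ k,
      π i * ((A ^ l) i k * (A ^ m) k j) * dist (x i) (x k) ^ 2 := by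
    rw [e0]
    simp only [← Finset.sum_mul, h.pow_sum, one_mul, energy]
  have e3 : energy x π A m = ∑ i, ∑ j, ∑ k,
      π i * ((A ^ l) i k * (A ^ m) k j) * dist (x k) (x j) ^ 2 := by
    rw [e0]
    rw [Finset.sum_comm]
    simp only [← Finset.sum_mul]
    have : ∀ k, ∑ i, π i * (A ^ l) i k = π k := fun k => by
      rw [Finset.sum_congr rfl fun i _ => h.pow_reversible l i k, ← Finset.mul_sum, h.pow_sum,
        mul_one]
    simp only [this, energy, Finset.mul_sum, mul_assoc]
  rw [e1, e2, e3]
  simp only [Finset.mul_sum]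
  simp only [← Finset.sum_add_distrib]
  refine Finset.sum_le_sum fun i _ => Finset.sum_le_sum fun j _ => Finset.sum_le_sum fun k _ => ?_
  have hw : 0 ≤ π i * ((A ^ l) i k * (A ^ m) k j) :=
    mul_nonneg (h.init_nonneg i) (mul_nonneg (h.pow_nonneg l i k) (h.pow_nonneg m k j))
  have hd : dist (x i) (x j) ^ 2 ≤
      (1 + s) * dist (x i) (x k) ^ 2 + (1 + s⁻¹) * dist (x k) (x j) ^ 2 := by
    refine (pow_le_pow_left₀ dist_nonneg (dist_triangle (x i) (x k) (x j)) 2).trans ?_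
    have h1 : 0 ≤ s⁻¹ * (s * dist (x i) (x k) - dist (x k) (x j)) ^ 2 := by positivity
    have h2 : s⁻¹ * (s * dist (x i) (x k) - dist (x k) (x j)) ^ 2 =
        s * dist (x i) (x k) ^ 2 + s⁻¹ * dist (x k) (x j) ^ 2
          - 2 * dist (x i) (x k) * dist (x k) (x j) := by
      field_simp
      ring
    linarith
  linarith [mul_le_mul_of_nonneg_left hd hw]

theorem energy_le (h : IsReversibleChain π A)
    (H : ∀ y z : X, ∃ m, IsComparisonMidpoint y z m) (x : Fin N → X) {l : ℕ} (hl : 1 ≤ l) :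
    energy x π A l ≤ (1 + Real.sqrt 2) ^ 2 * l * energy x π A 1 := by
  induction l using Nat.strong_induction_on with
  | _ l ih =>
    set c : ℝ := 1 + Real.sqrt 2 with hc
    have h2 : Real.sqrt 2 ^ 2 = 2 := Real.sq_sqrt zero_le_two
    have hc1 : 1 ≤ c := by rw [hc]; linarith [Real.sqrt_nonneg 2]
    have hcc : c ^ 2 = 1 + 2 * c := by rw [hc]; nlinarith
    have hE := h.energy_nonneg x 1
    obtain ⟨n, hnl, hln⟩ : ∃ n, 2 ^ n ≤ l ∧ l < 2 ^ (n + 1) :=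
      ⟨Nat.log 2 l, Nat.pow_log_le_self 2 (by omega), Nat.lt_pow_succ_log_self (by norm_num) l⟩
    obtain ⟨m, rfl⟩ := Nat.exists_eq_add_of_le hnl
    rw [pow_succ] at hln
    have hm : m < 2 ^ n := by omega
    have hpow := h.energy_two_pow_le H x n
    rcases Nat.eq_zero_or_pos m with rfl | hm0
    · rw [add_zero]
      refine hpow.trans (mul_le_mul_of_nonneg_right ?_ hE)
      push_cast
      have : (1 : ℝ) ≤ c ^ 2 := one_le_pow₀ hc1
      nlinarith [pow_pos (zero_lt_two' ℝ) n]
    · have hm' := ih m (by omega) hm0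
      set a : ℝ := Real.sqrt (2 ^ n) with ha
      set b : ℝ := Real.sqrt m with hb
      have ha2 : a ^ 2 = 2 ^ n := Real.sq_sqrt (by positivity)
      have hb2 : b ^ 2 = m := Real.sq_sqrt (by positivity)
      have ha0 : 0 < a := Real.sqrt_pos.2 (by positivity)
      have hb0 : 0 < b := Real.sqrt_pos.2 (by exact_mod_cast hm0)
      have hba : b ≤ a := Real.sqrt_le_sqrt (by exact_mod_cast hm.le)
      -- This weight minimizes the bound from `energy_add_le`, turning it into `(a + c * b) ^ 2`
      -- times the one-step energy.
      have hs : 0 < c * b / a := by positivity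
      have hadd := h.energy_add_le x (2 ^ n) m hs
      have h3 := mul_le_mul_of_nonneg_left hpow (by positivity : 0 ≤ 1 + c * b / a)
      have h4 := mul_le_mul_of_nonneg_left hm' (by positivity : 0 ≤ 1 + (c * b / a)⁻¹)
      rw [← ha2] at h3
      rw [← hb2] at h4
      have h5 : (1 + c * b / a) * (a ^ 2 * energy x π A 1)
          + (1 + (c * b / a)⁻¹) * (c ^ 2 * b ^ 2 * energy x π A 1) =
          (a + c * b) ^ 2 * energy x π A 1 := by
        field_simp
        ring
      have h6 : (a + c * b) ^ 2 ≤ c ^ 2 * (a ^ 2 + b ^ 2) := by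
        have : (a + c * b) ^ 2 = a ^ 2 + 2 * c * (a * b) + c ^ 2 * b ^ 2 := by ring
        have h7 : c * (a * b) ≤ c * a ^ 2 :=
          mul_le_mul_of_nonneg_left (by nlinarith) (by linarith)
        have h8 : c ^ 2 * a ^ 2 = a ^ 2 + 2 * (c * a ^ 2) := by rw [hcc]; ring
        linarith
      have h7 := mul_le_mul_of_nonneg_right h6 hE
      push_cast
      rw [← ha2, ← hb2]
      linarith

end IsReversibleChain

/-! ### From powers to the resolvent. -/

section MatrixNorm

attribute [local instance] Matrix.linftyOpNormedRing Matrix.linftyOpNormedAlgebra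

/-- Neumann series: a stochastic matrix has row-sum norm at most `1`. -/
theorem hasSum_resolventMatrix (h : IsReversibleChain π A) {α : ℝ} (h0 : 0 < α) (h1 : α < 1)
    (i j : Fin N) :
    HasSum (fun l : ℕ => (1 - α) * (α ^ l * (A ^ l) i j)) (resolventMatrix α A i j) := by
  have hnorm : ‖α • A‖ < 1 := by
    refine lt_of_le_of_lt ?_ h1
    rw [norm_smul, Real.norm_of_nonneg h0.le]
    refine mul_le_of_le_one_right h0.le ?_
    rw [Matrix.linfty_opNorm_def]
    refine NNReal.coe_le_one.2 (Finset.sup_le fun k _ => ?_)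
    rw [← NNReal.coe_le_coe]
    push_cast
    simp only [Real.norm_of_nonneg (h.trans_nonneg k _), h.trans_sum k, le_refl]
  have hsum : HasSum (fun l : ℕ => (α • A) ^ l) (1 - α • A)⁻¹ := by
    rw [Matrix.inv_eq_right_inv (mul_neg_geom_series _ hnorm)]
    exact (summable_geometric_of_norm_lt_one hnorm).hasSum
  have hij : HasSum (fun l : ℕ => ((α • A) ^ l) i j) ((1 - α • A)⁻¹ i j) :=
    Pi.hasSum.1 (Pi.hasSum.1 hsum i) j
  simp only [smul_pow, Matrix.smul_apply, smul_eq_mul] at hij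
  exact hij.mul_left (1 - α)

end MatrixNorm

/-- The resolvent averages the energies with geometric weights `(1 - α) α^l`, whose mean `α / (1 -
α)` accounts for the factors in the definition. -/
theorem markovTypeTwoWith_of_energy_le {K : ℝ}
    (hK : ∀ (l : ℕ), 1 ≤ l → ∀ (N : ℕ) (x : Fin N → X) (π : Fin N → ℝ)
      (A : Matrix (Fin N) (Fin N) ℝ), IsReversibleChain π A →
        energy x π A l ≤ K ^ 2 * l * energy x π A 1) : MarkovTypeTwoWith X K := by
  intro α h0 h1 N x π A h
  have hs : HasSum (fun l : ℕ => (1 - α) * α ^ l * energy x π A l)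
      (∑ i, ∑ j, π i * resolventMatrix α A i j * dist (x i) (x j) ^ 2) := by
    have := hasSum_sum fun i (_ : i ∈ Finset.univ) => hasSum_sum fun j (_ : j ∈ Finset.univ) =>
      ((hasSum_resolventMatrix h h0 h1 i j).mul_left (π i)).mul_right (dist (x i) (x j) ^ 2)
    refine (congrArg (fun f => HasSum f _) (funext fun l => ?_)).mpr this
    simp only [energy, Finset.mul_sum]
    exact Finset.sum_congr rfl fun i _ => Finset.sum_congr rfl fun j _ => by ring
  have hg := (hasSum_coe_mul_geometric_of_norm_lt_one (r := α)
    (by rwa [Real.norm_of_nonneg h0.le])).mul_left ((1 - α) * (K ^ 2 * energy x π A 1))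
  have hle := hasSum_le (fun l => ?_) hs hg
  · have h2 := mul_le_mul_of_nonneg_left hle (sub_nonneg.2 h1.le)
    refine h2.trans (le_of_eq ?_)
    have h3 : 1 - α ≠ 0 := (sub_pos.2 h1).ne'
    have h4 : energy x π A 1 = ∑ i, ∑ j, π i * A i j * dist (x i) (x j) ^ 2 := by
      simp only [energy, pow_one]
    rw [← h4]
    field_simp
  · have hα : 0 ≤ (1 - α) * α ^ l := mul_nonneg (sub_nonneg.2 h1.le) (by positivity)
    rcases Nat.eq_zero_or_pos l with rfl | hl
    · simp [energy, Matrix.one_apply]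
    · refine (mul_le_mul_of_nonneg_left (hK l hl N x π A h) hα).trans (le_of_eq ?_)
      ring

end Chains

end MarkovTypeTwo

theorem theorem4p2 {X : Type*} [MetricSpace X] (hX : MarkovTypeTwo.IsAlexandrovNonneg X) :
    MarkovTypeTwo.HasMarkovTypeTwo X ∧
    MarkovTypeTwo.markovConst X ≤ 1 + Real.sqrt 2 ∧
    ∀ (l : ℕ), 1 ≤ l → ∀ (N : ℕ) (x : Fin N → X) (π : Fin N → ℝ)
      (A : Matrix (Fin N) (Fin N) ℝ), MarkovTypeTwo.IsReversibleChain π A →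
        ∑ i, ∑ j, π i * (A ^ l) i j * dist (x i) (x j) ^ 2 ≤
          (1 + Real.sqrt 2) ^ 2 * l * ∑ i, ∑ j, π i * A i j * dist (x i) (x j) ^ 2 := by
  have hE : ∀ (l : ℕ), 1 ≤ l → ∀ (N : ℕ) (x : Fin N → X) (π : Fin N → ℝ)
      (A : Matrix (Fin N) (Fin N) ℝ), MarkovTypeTwo.IsReversibleChain π A →
        MarkovTypeTwo.energy x π A l ≤
          (1 + Real.sqrt 2) ^ 2 * l * MarkovTypeTwo.energy x π A 1 :=
    fun l hl N x π A h => h.energy_le hX.exists_isComparisonMidpoint x hl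
  have hK : (1 : ℝ) ≤ 1 + Real.sqrt 2 := le_add_of_nonneg_right (Real.sqrt_nonneg 2)
  have hM := MarkovTypeTwo.markovTypeTwoWith_of_energy_le hE
  refine ⟨⟨_, hK, hM⟩, csInf_le ⟨1, fun K h => h.1⟩ ⟨hK, hM⟩, fun l hl N x π A h => ?_⟩
  simpa only [MarkovTypeTwo.energy, pow_one] using hE l hl N x π A h
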